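/- Let $\tau=\{\tau(x)\}_{x\in\mathbb Z}$ be a family of positive random variables that is stationary and ergodic with respect to spatial translations and satisfies $\mathbb E[\tau(0)]<\infty$. Given a realization of $\tau$, consider the nearest-neighbour random walk on $\mathbb Z$ with jump rates $$c(x,y)=\tau(x\vee y)^{-1}\ \text{ if } |x-y|=1,\qquad c(x,y)=0\ \text{ otherwise.}$$ For an integer $n\ge 1$ let $\mathbb L_n$ be its Markov generator with Dirichlet conditions outside $(0,n)$, i.e. the operator on $\{f:[0,n]\cap\mathbb Z\to\mathbb C:\ f(0)=f(n)=0\}$ given by $$\mathbb L_nf(x)=c(x,x-1)\,[f(x-1)-f(x)]+c(x,x+1)\,[f(x+1)-f(x)]\quad\text{for } 0<x<n,$$ and $\mathbb L_nf(0)=\mathbb L_nf(n)=0$. Then for almost every realization of $\tau$ the following holds. For every $n\ge 1$ the operator $-\mathbb L_n$ has exactly $n-1$ eigenvalues, all positive and simple; write them as $\lambda_1^{(n)}(\tau)<\lambda_2^{(n)}(\tau)<\dots<\lambda_{n-1}^{(n)}(\tau)$. For every $k\ge 1$, $$\lim_{n\to\infty} n^2\,\mathbb E[\tau(0)]\,\lambda_k^{(n)}(\tau)=\pi^2k^2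 .$$ -/

import Mathlib

open MeasureTheory Filter Topology

namespace BarrierModel

/-- Jump rates of the barrier model with environment `t : ℤ → ℝ`:
`c(x,y) = t(x ∨ y)⁻¹` if `|x - y| = 1`, and `c(x,y) = 0` otherwise. -/
noncomputable def rate (t : ℤ → ℝ) (x y : ℤ) : ℝ :=
  if |x - y| = 1 then (t (max x y))⁻¹ else 0

/-- Pointwise generator of the nearest-neighbour random walk on `ℤ` with jump rates `c`. -/
noncomputable def generator (c : ℤ → ℤ → ℝ) (f : ℤ → ℂ) (x : ℤ) : ℂ :=
  (c x (x - 1) : ℂ) * (f (x - 1) - f x) + (c x (x + 1) : ℂ) * (f (x + 1) - f x)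

/-- The complex functions on `[0,n] ∩ ℤ` that vanish at `0` and `n`. They are represented by
their extension by zero to `ℤ`, i.e. as functions on `ℤ` that vanish outside `(0,n)`. -/
def dirichletSpace (n : ℕ) : Submodule ℂ (ℤ → ℂ) where
  carrier := {f | ∀ x : ℤ, x ∉ Set.Ioo (0 : ℤ) (n : ℤ) → f x = 0}
  zero_mem' := fun _ _ => rfl
  add_mem' := by
    intro f g hf hg x hx
    simp [hf x hx, hg x hx]
  smul_mem' := by
    intro a f hf x hx
    simp [hf x hx]

open scoped Classical in
/-- The generator with Dirichlet conditions outside `(0,n)`: it acts as `generator c` at the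
points of `(0,n) ∩ ℤ`, and the result is set to zero elsewhere. -/
noncomputable def dirichletGenerator (c : ℤ → ℤ → ℝ) (n : ℕ) :
    Module.End ℂ (dirichletSpace n) where
  toFun f := ⟨fun x => if x ∈ Set.Ioo (0 : ℤ) (n : ℤ) then generator c f.1 x else 0, by
    intro x hx
    exact if_neg hx⟩
  map_add' := by
    intro f g
    ext x
    by_cases hx : x ∈ Set.Ioo (0 : ℤ) (n : ℤ)
    · simp only [generator, hx, if_true, Submodule.coe_add, Pi.add_apply]
      ring
    · simp only [if_neg hx, Submodule.coe_add, Pi.add_apply, add_zero]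
  map_smul' := by
    intro a f
    ext x
    by_cases hx : x ∈ Set.Ioo (0 : ℤ) (n : ℤ)
    · simp only [generator, hx, if_true, Submodule.coe_smul, Pi.smul_apply, smul_eq_mul,
        RingHom.id_apply]
      ring
    · simp only [if_neg hx, Submodule.coe_smul, Pi.smul_apply, smul_zero]

/-- `l 1 < l 2 < ⋯ < l (n - 1)` are exactly the (complex) eigenvalues of minus the barrier
model generator with Dirichlet conditions outside `(0,n)`, and they are all positive and
simple. The values `l k` with `k = 0` or `k ≥ n` play no role. -/
structure IsDirichletEigenvalueList (t : ℤ → ℝ) (n : ℕ) (l : ℕ → ℝ) : Prop where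
  strictMono : StrictMonoOn l (Set.Ico 1 n)
  eigenvalues : (fun k => (l k : ℂ)) '' Set.Ico 1 n =
    {z : ℂ | (-dirichletGenerator (rate t) n).HasEigenvalue z}
  pos : ∀ k ∈ Set.Ico 1 n, 0 < l k
  simple : ∀ k ∈ Set.Ico 1 n,
    Module.finrank ℂ ((-dirichletGenerator (rate t) n).maxGenEigenspace (l k : ℂ)) = 1

/-- The family `τ = (τ x)_{x ∈ ℤ}` of random variables is stationary and ergodic with respect to
spatial translations: its law on `ℤ → ℝ` is preserved by the shift, and shift-invariant events
have probability zero or one. -/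
def IsErgodicEnvironment {Ω : Type*} [MeasurableSpace Ω] (μ : Measure Ω) (τ : ℤ → Ω → ℝ) :
    Prop :=
  Ergodic (fun (t : ℤ → ℝ) (x : ℤ) => t (x + 1)) (μ.map fun ω x => τ x ω)

end BarrierModel

/-! The limit is easiest to see on the inverse operator. The matrix of `-L_n` is symmetric and
positive, and its inverse is the Green kernel `S(x ∧ y) (S(n) - S(x ∨ y)) / S(n)` with `S(x) = τ(1)
+ ⋯ + τ(x)` (`dirichletOp_mul_greenOp`). The environment enters only through `S`, and the ergodic
theorem says that `S` is linear on `[0,n]` with slope `m = E[τ(0)]`, up to a uniform error `o(n)`.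

The kernel is Lipschitz in `S` for the sup norm (`abs_green_sub_le`), so replacing `τ` by the
constant `m` changes each entry by `o(n)` and the quadratic form by `o(n²)‖f‖²`. By Weyl's
inequality each inverse eigenvalue then moves by `o(n²)`
(`IsDirichletEigenvalueList.inv_le_inv_add`). For constant `m` the eigenfunctions are sines, and the
inverse eigenvalues are explicit and of order `n²`. Simplicity of the spectrum comes from the
second-order recurrence satisfied by eigenfunctions. -/

/-! ### Birkhoff's ergodic theorem, by Garsia's running-maximum argument. -/

section PointwiseErgodicTheorem

variable {α : Type*}

/-- The running maximum `max (0, S₁, …, Sₙ)` of the Birkhoff sums of `f` along `T`. -/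
noncomputable def birkhoffMax (T : α → α) (f : α → ℝ) : ℕ → α → ℝ
  | 0 => fun _ => 0
  | n + 1 => fun x => max 0 (f x + birkhoffMax T f n (T x))

theorem birkhoffMax_nonneg (T : α → α) (f : α → ℝ) (n : ℕ) (x : α) :
    0 ≤ birkhoffMax T f n x := by
  cases n with
  | zero => exact le_rfl
  | succ n => exact le_max_left _ _

theorem birkhoffSum_le_birkhoffMax (T : α → α) (f : α → ℝ) (n : ℕ) (x : α) :
    birkhoffSum T f n x ≤ birkhoffMax T f n x := by
  induction n generalizing x with
  | zero => simp [birkhoffMax]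
  | succ n ih =>
    rw [birkhoffSum_succ']
    exact le_trans (by linarith [ih (T x)]) (le_max_right _ _)

theorem birkhoffMax_le_succ (T : α → α) (f : α → ℝ) (n : ℕ) (x : α) :
    birkhoffMax T f n x ≤ birkhoffMax T f (n + 1) x := by
  induction n generalizing x with
  | zero => exact birkhoffMax_nonneg _ _ _ _
  | succ n ih => exact max_le_max le_rfl (by linarith [ih (T x)])

theorem birkhoffMax_monotone (T : α → α) (f : α → ℝ) (x : α) :
    Monotone fun n => birkhoffMax T f n x :=
  monotone_nat_of_le_succ fun n => birkhoffMax_le_succ T f n x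

/-- Under an invariant measure the left side has non-negative integral, while the right side equals
`f x` once the maximum at `T x` is large. -/
theorem birkhoffMax_succ_sub (T : α → α) (f : α → ℝ) (n : ℕ) (x : α) :
    birkhoffMax T f (n + 1) x - birkhoffMax T f n (T x) =
      max (-birkhoffMax T f n (T x)) (f x) := by
  simp only [birkhoffMax]
  rw [← max_sub_sub_right]
  congr 1 <;> ring

/-- Strict invariance of the boundedness event, so that ergodicity gives it probability zero or one.
-/
theorem bddAbove_birkhoffMax_comp_iff (T : α → α) (f : α → ℝ) (x : α) :
    BddAbove (Set.range fun n => birkhoffMax T f n (T x)) ↔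
      BddAbove (Set.range fun n => birkhoffMax T f n x) := by
  simp only [bddAbove_def, Set.forall_mem_range]
  constructor
  · rintro ⟨K, hK⟩
    refine ⟨max 0 (f x + K), fun n => (birkhoffMax_le_succ T f n x).trans ?_⟩
    exact max_le_max le_rfl (by linarith [hK n])
  · rintro ⟨K, hK⟩
    refine ⟨K - f x, fun n => ?_⟩
    have := (le_max_right _ _).trans (hK (n + 1))
    linarith

variable [MeasurableSpace α]

theorem measurable_birkhoffMax {T : α → α} (hT : Measurable T) {f : α → ℝ} (hf : Measurable f)
    (n : ℕ) : Measurable (birkhoffMax T f n) := by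
  induction n with
  | zero => exact measurable_const
  | succ n ih => exact measurable_const.max (hf.add (ih.comp hT))

theorem measurableSet_bddAbove_birkhoffMax {T : α → α} (hT : Measurable T) {f : α → ℝ}
    (hf : Measurable f) :
    MeasurableSet {x | BddAbove (Set.range fun n => birkhoffMax T f n x)} :=
  measurableSet_bddAbove_range fun n => measurable_birkhoffMax hT hf n

variable {μ : Measure α}

theorem integrable_birkhoffMax {T : α → α} (hT : MeasurePreserving T μ μ)
    {f : α → ℝ} (hf : Integrable f μ) (n : ℕ) : Integrable (birkhoffMax T f n) μ := by
  induction n with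
  | zero => exact integrable_zero _ _ _
  | succ n ih =>
    have := (hf.add (hT.integrable_comp_of_integrable ih)).pos_part
    refine this.congr (ae_of_all _ fun x => ?_)
    exact max_comm _ _

/-- If `T` is ergodic and `f` has negative mean, then the Birkhoff sums of `f` are almost surely
bounded above. -/
theorem Ergodic.ae_bddAbove_birkhoffMax [IsProbabilityMeasure μ] {T : α → α} (hT : Ergodic T μ)
    {f : α → ℝ} (hfm : Measurable f) (hf : Integrable f μ) (hneg : ∫ x, f x ∂μ < 0) :
    ∀ᵐ x ∂μ, BddAbove (Set.range fun n => birkhoffMax T f n x) := by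
  have hmp := hT.toMeasurePreserving
  rcases hT.toPreErgodic.ae_mem_or_ae_notMem
    (measurableSet_bddAbove_birkhoffMax hmp.measurable hfm)
    (Set.ext fun x => bddAbove_birkhoffMax_comp_iff T f x) with h | h
  · exact h
  exfalso
  -- If the maxima are almost surely unbounded, the truncation in `birkhoffMax_succ_sub` eventually
  -- disappears; `|f|` dominates throughout.
  have hlim : Tendsto (fun n => ∫ x, max (-birkhoffMax T f n (T x)) (f x) ∂μ) atTop
      (𝓝 (∫ x, f x ∂μ)) := by
    refine tendsto_integral_of_dominated_convergence (fun x => |f x|) (fun n => ?_) hf.abs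
      (fun n => ae_of_all _ fun x => ?_) ?_
    · exact (((measurable_birkhoffMax hmp.measurable hfm n).comp hmp.measurable).neg.max
        hfm).aestronglyMeasurable
    · rw [Real.norm_eq_abs, abs_le]
      exact ⟨(neg_abs_le _).trans (le_max_right _ _),
        max_le (by linarith [birkhoffMax_nonneg T f n (T x), abs_nonneg (f x)]) (le_abs_self _)⟩
    · filter_upwards [h] with x hx
      have hx' : ¬ BddAbove (Set.range fun n => birkhoffMax T f n (T x)) := fun hb =>
        hx ((bddAbove_birkhoffMax_comp_iff T f x).1 hb)
      have htop := tendsto_atTop_atTop_of_monotone' (birkhoffMax_monotone T f (T x)) hx'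
      refine tendsto_const_nhds.congr' ?_
      filter_upwards [htop.eventually_ge_atTop (-f x)] with n hn
      exact (max_eq_right (by linarith)).symm
  refine absurd (ge_of_tendsto' hlim fun n => ?_) (not_le.2 hneg)
  have hi := integrable_birkhoffMax hmp hf
  have h1 : ∫ x, max (-birkhoffMax T f n (T x)) (f x) ∂μ =
      ∫ x, birkhoffMax T f (n + 1) x ∂μ - ∫ x, birkhoffMax T f n (T x) ∂μ := by
    refine Eq.trans ?_ (integral_sub (hi (n + 1)) (hmp.integrable_comp_of_integrable (hi n)))
    exact integral_congr_ae (ae_of_all _ fun x => (birkhoffMax_succ_sub T f n x).symm)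
  have h2 : ∫ x, birkhoffMax T f n (T x) ∂μ = ∫ x, birkhoffMax T f n x ∂μ := by
    have := integral_map (f := birkhoffMax T f n) hmp.measurable.aemeasurable
      (by rw [hmp.map_eq]; exact (hi n).aestronglyMeasurable)
    rw [← this, hmp.map_eq]
  rw [h1, h2, sub_nonneg]
  exact integral_mono (hi n) (hi (n + 1)) (birkhoffMax_le_succ T f n)

theorem Ergodic.ae_eventually_birkhoffSum_le [IsProbabilityMeasure μ] {T : α → α}
    (hT : Ergodic T μ) {f : α → ℝ} (hfm : Measurable f) (hf : Integrable f μ) {ε : ℝ}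
    (hε : 0 < ε) :
    ∀ᵐ x ∂μ, ∀ᶠ n : ℕ in atTop, birkhoffSum T f n x ≤ n * (∫ y, f y ∂μ + ε) := by
  set a := ∫ y, f y ∂μ
  -- Half of `ε` makes the mean negative; the other half absorbs the random bound `K` once `n` is
  -- large.
  have hneg : ∫ x, (f x - (a + ε / 2)) ∂μ < 0 := by
    rw [integral_sub hf (integrable_const _)]
    simp only [integral_const, probReal_univ, smul_eq_mul, one_mul]
    linarith
  filter_upwards [hT.ae_bddAbove_birkhoffMax (hfm.sub_const _) (hf.sub (integrable_const _)) hneg]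
    with x hx
  obtain ⟨K, hK⟩ := hx
  filter_upwards [(tendsto_natCast_atTop_atTop (R := ℝ)).eventually_ge_atTop (K / (ε / 2))]
    with n hn
  have h1 := (birkhoffSum_le_birkhoffMax T (fun x => f x - (a + ε / 2)) n x).trans
    (hK (Set.mem_range_self n))
  have h2 : birkhoffSum T (fun x => f x - (a + ε / 2)) n x =
      birkhoffSum T f n x - n * (a + ε / 2) := by
    simp only [birkhoffSum, Finset.sum_sub_distrib, Finset.sum_const, Finset.card_range,
      nsmul_eq_mul]
  rw [div_le_iff₀ (by positivity)] at hn
  rw [h2] at h1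
  linarith

/-- Birkhoff's pointwise ergodic theorem for ergodic maps of a probability space. -/
theorem Ergodic.ae_tendsto_birkhoffSum_div [IsProbabilityMeasure μ] {T : α → α}
    (hT : Ergodic T μ) {f : α → ℝ} (hfm : Measurable f) (hf : Integrable f μ) :
    ∀ᵐ x ∂μ, Tendsto (fun n : ℕ => birkhoffSum T f n x / n) atTop (𝓝 (∫ y, f y ∂μ)) := by
  have h1 : ∀ᵐ x ∂μ, ∀ j : ℕ, ∀ᶠ n : ℕ in atTop,
      birkhoffSum T f n x ≤ n * (∫ y, f y ∂μ + 1 / ((j : ℝ) + 1)) :=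
    ae_all_iff.2 fun j => hT.ae_eventually_birkhoffSum_le hfm hf (by positivity)
  have h2 : ∀ᵐ x ∂μ, ∀ j : ℕ, ∀ᶠ n : ℕ in atTop,
      birkhoffSum T (-f) n x ≤ n * (∫ y, (-f) y ∂μ + 1 / ((j : ℝ) + 1)) :=
    ae_all_iff.2 fun j => hT.ae_eventually_birkhoffSum_le hfm.neg hf.neg (by positivity)
  filter_upwards [h1, h2] with x h1 h2
  rw [Metric.tendsto_atTop']
  intro ε hε
  obtain ⟨j, hj⟩ := exists_nat_one_div_lt hε
  obtain ⟨N, hN⟩ := eventually_atTop.1 ((h1 j).and (h2 j))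
  refine ⟨N, fun n hn => ?_⟩
  obtain ⟨h3, h4⟩ := hN n hn.le
  have hn0 : (0 : ℝ) < n := by exact_mod_cast (Nat.zero_le N).trans_lt hn
  rw [birkhoffSum_neg] at h4
  simp only [Pi.neg_apply, integral_neg] at h4
  rw [Real.dist_eq, abs_lt]
  constructor
  · rw [lt_sub_iff_add_lt, lt_div_iff₀ hn0]
    nlinarith
  · rw [sub_lt_iff_lt_add, div_lt_iff₀ hn0]
    nlinarith

end PointwiseErgodicTheorem

/-! ### Comparison of ordered eigenvalues. -/

section Weyl

variable {𝕜 E ι : Type*} [RCLike 𝕜] [NormedAddCommGroup E] [InnerProductSpace 𝕜 E] [Fintype ι]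

theorem OrthonormalBasis.re_inner_map_self_of_eigenbasis (u : OrthonormalBasis ι 𝕜 E)
    {A : E →ₗ[𝕜] E} {a : ι → ℝ} (hA : ∀ i, A (u i) = (a i : 𝕜) • u i) (f : E) :
    RCLike.re (inner 𝕜 f (A f)) = ∑ i, a i * ‖u.repr f i‖ ^ 2 := by
  have hAf : A f = ∑ i, (u.repr f i * (a i : 𝕜)) • u i := by
    conv_lhs => rw [← u.sum_repr f]
    simp [map_sum, hA, smul_smul]
  rw [hAf, inner_sum, map_sum]
  refine Finset.sum_congr rfl fun i _ => ?_
  rw [inner_smul_right, ← inner_conj_symm, ← u.repr_apply_apply, mul_right_comm,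
    RCLike.mul_conj, ← RCLike.ofReal_pow, ← RCLike.ofReal_mul, RCLike.ofReal_re, mul_comm]

/-- Weyl's inequality for two diagonalized operators. -/
theorem OrthonormalBasis.eigenvalue_le_add_of_re_inner_le [LinearOrder ι]
    (u v : OrthonormalBasis ι 𝕜 E) {A B : E →ₗ[𝕜] E} {a b : ι → ℝ} (ha : Antitone a)
    (hb : Antitone b) (hA : ∀ i, A (u i) = (a i : 𝕜) • u i)
    (hB : ∀ i, B (v i) = (b i : 𝕜) • v i) {ε : ℝ}
    (h : ∀ f, RCLike.re (inner 𝕜 f (A f)) ≤ RCLike.re (inner 𝕜 f (B f)) + ε * ‖f‖ ^ 2) (i : ι) :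
    a i ≤ b i + ε := by
  classical
  have : FiniteDimensional 𝕜 E := u.toBasis.finiteDimensional_of_finite
  -- The kernel of `Φ` is the span of `u j`, `j ≤ i`, intersected with that of `v j`, `j ≥ i`. One
  -- condition for each `j ≠ i` is one fewer than the dimension, so it is nonzero; on it the form of
  -- `A` is at least `a i` and that of `B` at most `b i`, times `‖f‖²`.
  let Φ : E →ₗ[𝕜] ({j // j ≠ i} → 𝕜) :=
    LinearMap.pi fun j => if i < j.1 then u.toBasis.coord j else v.toBasis.coord j
  have hdim : Module.finrank 𝕜 ({j // j ≠ i} → 𝕜) < Module.finrank 𝕜 E := by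
    rw [Module.finrank_fintype_fun_eq_card, Module.finrank_eq_card_basis u.toBasis]
    exact Fintype.card_subtype_lt (x := i) (by simp)
  obtain ⟨f, hf, hf0⟩ := Submodule.exists_mem_ne_zero_of_ne_bot
    (LinearMap.ker_ne_bot_of_finrank_lt (f := Φ) hdim)
  have hu : ∀ j, i < j → u.repr f j = 0 := fun j hj => by
    have := congrFun (LinearMap.mem_ker.1 hf) ⟨j, hj.ne'⟩
    simpa [Φ, hj] using this
  have hv : ∀ j, j < i → v.repr f j = 0 := fun j hj => by
    have := congrFun (LinearMap.mem_ker.1 hf) ⟨j, hj.ne⟩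
    simpa [Φ, hj.not_gt] using this
  have hnorm : ∀ w : OrthonormalBasis ι 𝕜 E, ∑ j, ‖w.repr f j‖ ^ 2 = ‖f‖ ^ 2 := fun w => by
    rw [← EuclideanSpace.norm_sq_eq, LinearIsometryEquiv.norm_map]
  have h1 : a i * ‖f‖ ^ 2 ≤ RCLike.re (inner 𝕜 f (A f)) := by
    rw [u.re_inner_map_self_of_eigenbasis hA, ← hnorm u, Finset.mul_sum]
    refine Finset.sum_le_sum fun j _ => ?_
    rcases lt_or_ge i j with hj | hj
    · simp [hu j hj]
    · exact mul_le_mul_of_nonneg_right (ha hj) (by positivity)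
  have h2 : RCLike.re (inner 𝕜 f (B f)) ≤ b i * ‖f‖ ^ 2 := by
    rw [v.re_inner_map_self_of_eigenbasis hB, ← hnorm v, Finset.mul_sum]
    refine Finset.sum_le_sum fun j _ => ?_
    rcases lt_or_ge j i with hj | hj
    · simp [hv j hj]
    · exact mul_le_mul_of_nonneg_right (hb hj) (by positivity)
  have hpos : 0 < ‖f‖ ^ 2 := by positivity
  refine le_of_mul_le_mul_right ?_ hpos
  linarith [h f]

end Weyl

/-! ### Quadratic forms of kernels with small entries. -/

section KernelBound

variable {𝕜 ι : Type*} [RCLike 𝕜] [Fintype ι]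

theorem EuclideanSpace.norm_inner_kernel_le {D : ι → ι → 𝕜} {δ : ℝ} (hD : ∀ i j, ‖D i j‖ ≤ δ)
    (f g : EuclideanSpace 𝕜 ι) (hg : ∀ i, g i = ∑ j, D i j * f j) :
    ‖inner 𝕜 f g‖ ≤ Fintype.card ι * δ * ‖f‖ ^ 2 := by
  rcases isEmpty_or_nonempty ι with hι | ⟨⟨i₀⟩⟩
  · simp [PiLp.inner_apply, EuclideanSpace.norm_sq_eq]
  have hδ : 0 ≤ δ := (norm_nonneg _).trans (hD i₀ i₀)
  calc ‖inner 𝕜 f g‖ = ‖∑ i, inner 𝕜 (f i) (∑ j, D i j * f j)‖ := by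
        simp only [PiLp.inner_apply, hg]
    _ ≤ ∑ i, ‖f i‖ * ∑ j, δ * ‖f j‖ := by
        refine (norm_sum_le _ _).trans (Finset.sum_le_sum fun i _ => ?_)
        refine (norm_inner_le_norm _ _).trans (mul_le_mul_of_nonneg_left ?_ (norm_nonneg _))
        refine (norm_sum_le _ _).trans (Finset.sum_le_sum fun j _ => ?_)
        rw [norm_mul]
        exact mul_le_mul_of_nonneg_right (hD i j) (norm_nonneg _)
    _ = δ * (∑ i, ‖f i‖) ^ 2 := by
        rw [← Finset.sum_mul, ← Finset.mul_sum]; ring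
    _ ≤ δ * (Fintype.card ι * ∑ i, ‖f i‖ ^ 2) :=
        mul_le_mul_of_nonneg_left sq_sum_le_card_mul_sum_sq hδ
    _ = Fintype.card ι * δ * ‖f‖ ^ 2 := by rw [EuclideanSpace.norm_sq_eq]; ring

end KernelBound

/-! ### The Dirichlet operator: symmetry, positivity, simple spectrum. -/

namespace BarrierModel

theorem rate_sub_one (t : ℤ → ℝ) (x : ℤ) : rate t x (x - 1) = (t x)⁻¹ := by
  simp [rate]

theorem rate_add_one (t : ℤ → ℝ) (x : ℤ) : rate t x (x + 1) = (t (x + 1))⁻¹ := by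
  simp [rate]

/-- The flux of `F` through the edge `(x, x + 1)`. -/
noncomputable def flux (t : ℤ → ℝ) (F : ℤ → ℂ) (x : ℤ) : ℂ :=
  ((t (x + 1) : ℂ))⁻¹ * (F (x + 1) - F x)

theorem generator_rate (t : ℤ → ℝ) (F : ℤ → ℂ) (x : ℤ) :
    generator (rate t) F x = flux t F x - flux t F (x - 1) := by
  simp only [generator, rate_sub_one, rate_add_one, flux, sub_add_cancel]
  push_cast
  ring

/-- Summation by parts. The remaining boundary term vanishes when `m = n` and `H` satisfies the
Dirichlet condition. -/
theorem sum_generator_mul (t : ℤ → ℝ) (F H : ℤ → ℂ) (h0 : H 0 = 0) (m : ℕ) :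
    ∑ k ∈ Finset.range m, -generator (rate t) F k * H k =
      ∑ k ∈ Finset.range m, flux t F k * (H (k + 1) - H k) - flux t F (m - 1) * H m := by
  induction m with
  | zero => simp [h0]
  | succ m ih =>
    rw [Finset.sum_range_succ, Finset.sum_range_succ, ih, generator_rate]
    push_cast
    rw [add_sub_cancel_right]
    ring

theorem sum_Ioo_eq_sum_range {M : Type*} [AddCommMonoid M] (n : ℕ) (φ : ℤ → M) (h0 : φ 0 = 0) :
    ∑ i : Set.Ioo (0 : ℤ) n, φ i = ∑ k ∈ Finset.range n, φ k := by
  have h1 : ∑ i : Set.Ioo (0 : ℤ) n, φ i = ∑ x ∈ Finset.Ioo (0 : ℤ) n, φ x := by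
    rw [Finset.sum_subtype (Finset.Ioo (0 : ℤ) n) (p := fun x => x ∈ Set.Ioo (0 : ℤ) n)]
    intro x
    simp
  have h2 : ∑ k ∈ Finset.range n, φ k = ∑ x ∈ Finset.Ico (0 : ℤ) n, φ x := by
    refine Finset.sum_nbij (fun k : ℕ => (k : ℤ)) ?_ ?_ ?_ (fun _ _ => rfl)
    · intro k hk
      simpa using hk
    · intro a _ b _ hab
      exact Nat.cast_injective hab
    · intro x hx
      simp only [Finset.coe_Ico, Set.mem_Ico] at hx
      exact ⟨x.toNat, by simp; omega, by simp [hx.1]⟩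
  rw [h1, h2]
  refine Finset.sum_subset (fun x hx => ?_) (fun x hx hx' => ?_)
  · simp only [Finset.mem_Ioo, Finset.mem_Ico] at hx ⊢
    omega
  · simp only [Finset.mem_Ioo, Finset.mem_Ico] at hx hx'
    have : x = 0 := by omega
    rw [this, h0]

/-- The Euclidean space of functions on `(0,n) ∩ ℤ`. -/
abbrev EuclideanIoo (n : ℕ) : Type := EuclideanSpace ℂ (Set.Ioo (0 : ℤ) n)

theorem card_Ioo_natCast (n : ℕ) : Fintype.card (Set.Ioo (0 : ℤ) n) = n - 1 := by
  rw [Fintype.card_ofFinset, Int.card_Ioo]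
  omega

theorem finrank_euclideanIoo (n : ℕ) : Module.finrank ℂ (EuclideanIoo n) = n - 1 := by
  rw [finrank_euclideanSpace, card_Ioo_natCast]

open scoped Classical in
/-- Restriction to `(0,n)` identifies `dirichletSpace n` with the Euclidean space of functions
on `(0,n) ∩ ℤ`; the inverse is extension by zero. -/
noncomputable def dirichletEquiv (n : ℕ) : dirichletSpace n ≃ₗ[ℂ] EuclideanIoo n where
  toFun F := WithLp.toLp 2 fun i => F.1 i
  invFun f := ⟨fun x => if h : x ∈ Set.Ioo (0 : ℤ) n then f ⟨x, h⟩ else 0,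
    fun _ hx => dif_neg hx⟩
  map_add' _ _ := rfl
  map_smul' _ _ := rfl
  left_inv F := by
    ext x
    by_cases h : x ∈ Set.Ioo (0 : ℤ) n
    · simp [h]
    · simp only [h, dif_neg, not_false_eq_true]
      exact (F.2 x h).symm
  right_inv f := by
    ext i
    exact dif_pos i.2

/-- Extension by zero of a function on `(0,n) ∩ ℤ`. -/
noncomputable def extendZero {n : ℕ} (f : EuclideanIoo n) : ℤ → ℂ := ((dirichletEquiv n).symm f).1

theorem extendZero_coe {n : ℕ} (f : EuclideanIoo n) (i : Set.Ioo (0 : ℤ) n) :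
    extendZero f i = f i := dif_pos i.2

theorem extendZero_of_notMem {n : ℕ} (f : EuclideanIoo n) {x : ℤ}
    (hx : x ∉ Set.Ioo (0 : ℤ) n) : extendZero f x = 0 := dif_neg hx

@[simp]
theorem extendZero_zero_right {n : ℕ} (f : EuclideanIoo n) : extendZero f 0 = 0 :=
  extendZero_of_notMem f (by simp)

@[simp]
theorem extendZero_natCast {n : ℕ} (f : EuclideanIoo n) : extendZero f n = 0 :=
  extendZero_of_notMem f (by simp)

theorem eq_zero_of_extendZero_eq_zero {n : ℕ} {f : EuclideanIoo n}
    (h : ∀ k : ℕ, k ≤ n → extendZero f k = 0) : f = 0 := by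
  ext i
  rw [← extendZero_coe]
  obtain ⟨x, hx0, hxn⟩ := i
  lift x to ℕ using hx0.le
  exact h x (by exact_mod_cast hxn.le)

/-- Minus the Dirichlet generator as an operator on Euclidean space. -/
noncomputable def dirichletOp (t : ℤ → ℝ) (n : ℕ) : Module.End ℂ (EuclideanIoo n) :=
  (dirichletEquiv n).conj (-dirichletGenerator (rate t) n)

theorem dirichletOp_apply (t : ℤ → ℝ) {n : ℕ} (f : EuclideanIoo n) (i : Set.Ioo (0 : ℤ) n) :
    dirichletOp t n f i = -generator (rate t) (extendZero f) i :=
  congrArg Neg.neg (if_pos i.2)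

theorem inner_dirichletOp (t : ℤ → ℝ) {n : ℕ} (f h : EuclideanIoo n) :
    inner ℂ f (dirichletOp t n h) = ∑ k ∈ Finset.range n, ((t (k + 1) : ℂ))⁻¹ *
      ((extendZero h (k + 1) - extendZero h k) *
        (starRingEnd ℂ) (extendZero f (k + 1) - extendZero f k)) := by
  have h1 : inner ℂ f (dirichletOp t n h) = ∑ i : Set.Ioo (0 : ℤ) n,
      -generator (rate t) (extendZero h) i * (starRingEnd ℂ) (extendZero f i) := by
    rw [PiLp.inner_apply]
    refine Finset.sum_congr rfl fun i _ => ?_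
    simp only [RCLike.inner_apply, dirichletOp_apply, extendZero_coe]
  have h2 := sum_Ioo_eq_sum_range n (fun x : ℤ =>
    -generator (rate t) (extendZero h) x * (starRingEnd ℂ) (extendZero f x)) (by simp)
  rw [h1, h2, sum_generator_mul t _ (fun x => (starRingEnd ℂ) (extendZero f x)) (by simp)]
  simp only [extendZero_natCast, map_zero, mul_zero, sub_zero, flux, map_sub, mul_assoc]

theorem dirichletOp_isSymmetric (t : ℤ → ℝ) (n : ℕ) : (dirichletOp t n).IsSymmetric := by
  intro f h
  rw [← inner_conj_symm, inner_dirichletOp, inner_dirichletOp, map_sum]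
  refine Finset.sum_congr rfl fun k _ => ?_
  simp only [map_mul, map_inv₀, Complex.conj_ofReal, Complex.conj_conj]
  ring

theorem re_inner_dirichletOp_pos {t : ℤ → ℝ} (ht : ∀ x, 0 < t x) {n : ℕ} {f : EuclideanIoo n}
    (hf : f ≠ 0) : 0 < (inner ℂ f (dirichletOp t n f)).re := by
  have h1 : (inner ℂ f (dirichletOp t n f)).re = ∑ k ∈ Finset.range n,
      (t (k + 1))⁻¹ * ‖extendZero f (k + 1) - extendZero f k‖ ^ 2 := by
    rw [inner_dirichletOp, Complex.re_sum]
    refine Finset.sum_congr rfl fun k _ => ?_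
    rw [Complex.mul_conj, ← Complex.ofReal_inv, ← Complex.ofReal_mul, Complex.ofReal_re,
      Complex.normSq_eq_norm_sq]
  rw [h1]
  have h2 : ∃ k ∈ Finset.range n, extendZero f (k + 1) - extendZero f k ≠ 0 := by
    by_contra! hc
    refine hf (eq_zero_of_extendZero_eq_zero fun k hk => ?_)
    induction k with
    | zero => simp
    | succ k ih =>
      have := hc k (Finset.mem_range.2 hk)
      push_cast
      rw [sub_eq_zero.1 this, ih (by omega)]
  refine Finset.sum_pos' (fun k _ => mul_nonneg (inv_nonneg.2 (ht _).le) (by positivity)) ?_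
  obtain ⟨k, hk, hk'⟩ := h2
  exact ⟨k, hk, mul_pos (inv_pos.2 (ht _)) (by positivity)⟩

/-- The eigenvalue equation is a second-order recurrence started from the value `0` at `0`, so an
eigenfunction is determined by its value at `1`. -/
theorem finrank_eigenspace_dirichletOp_le {t : ℤ → ℝ} (ht : ∀ x, 0 < t x) (n : ℕ) (z : ℂ) :
    Module.finrank ℂ ((dirichletOp t n).eigenspace z) ≤ 1 := by
  let φ : EuclideanIoo n →ₗ[ℂ] ℂ :=
    (LinearMap.proj (1 : ℤ)).comp
      ((dirichletSpace n).subtype.comp (dirichletEquiv n).symm.toLinearMap)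
  rw [← Module.finrank_self ℂ]
  refine LinearMap.finrank_le_finrank_of_injective
    (f := φ.comp ((dirichletOp t n).eigenspace z).subtype) ?_
  rw [← LinearMap.ker_eq_bot, LinearMap.ker_eq_bot']
  rintro ⟨f, hf⟩ hφ
  have h1 : extendZero f 1 = 0 := hφ
  rw [Module.End.mem_eigenspace_iff] at hf
  have hrec : ∀ k : ℕ, k + 1 ≤ n → extendZero f k = 0 ∧ extendZero f (k + 1) = 0 := by
    intro k
    induction k with
    | zero => intro _; simp [h1]
    | succ k ih =>
      intro hk
      obtain ⟨ih1, ih2⟩ := ih (by omega)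
      refine ⟨by exact_mod_cast ih2, ?_⟩
      have hmem : ((k : ℤ) + 1) ∈ Set.Ioo (0 : ℤ) n := ⟨by omega, by omega⟩
      have h := congrArg (fun g : EuclideanIoo n => g ⟨(k : ℤ) + 1, hmem⟩) hf
      simp only [dirichletOp_apply, PiLp.smul_apply, smul_eq_mul, generator_rate, flux] at h
      rw [← extendZero_coe] at h
      simp only [add_sub_cancel_right, ih1, ih2] at h
      have ht0 : (t ((k : ℤ) + 1 + 1) : ℂ) ≠ 0 := by exact_mod_cast (ht _).ne'
      push_cast
      simpa [ht0] using h
  have : f = 0 := eq_zero_of_extendZero_eq_zero fun k hk => by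
    cases k with
    | zero => simp
    | succ k => exact_mod_cast (hrec k hk).2
  exact Subtype.ext this

instance finite_dirichletSpace (n : ℕ) : Module.Finite ℂ (dirichletSpace n) :=
  Module.Finite.equiv (dirichletEquiv n).symm

theorem charpoly_dirichletOp (t : ℤ → ℝ) (n : ℕ) :
    (dirichletOp t n).charpoly = (-dirichletGenerator (rate t) n).charpoly :=
  LinearEquiv.charpoly_conj _ _

theorem exists_isDirichletEigenvalueList {t : ℤ → ℝ} (ht : ∀ x, 0 < t x) (n : ℕ) :
    ∃ l : ℕ → ℝ, IsDirichletEigenvalueList t n l ∧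
      ∃ u : OrthonormalBasis (Fin (n - 1)) ℂ (EuclideanIoo n),
        ∀ i, dirichletOp t n (u i) = (l (i + 1) : ℂ) • u i := by
  have hS := dirichletOp_isSymmetric t n
  have hn := finrank_euclideanIoo n
  have hinj : Function.Injective (hS.eigenvalues hn) := by
    intro i j hij
    have h1 := (hS.card_filter_eigenvalues_eq hn (hS.eigenvalues hn i : ℂ)).trans_le
      (finrank_eigenspace_dirichletOp_le ht n _)
    -- The multiplicity of a value in the list is the dimension of its eigenspace, hence at most
    -- one.
    exact Finset.card_le_one.1 h1 i (by simp) j (by simp [hij])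
  have hanti : StrictAnti (hS.eigenvalues hn) :=
    (hS.eigenvalues_antitone hn).strictAnti_of_injective hinj
  have hpos : ∀ i, 0 < hS.eigenvalues hn i := by
    intro i
    have h1 := re_inner_dirichletOp_pos ht (n := n)
      (f := hS.eigenvectorBasis hn i) (hS.hasEigenvector_eigenvectorBasis hn i).2
    rw [hS.apply_eigenvectorBasis, inner_smul_right, inner_self_eq_norm_sq_to_K] at h1
    simpa using h1
  have hroots := hS.roots_charpoly_eq_eigenvalues hn
  rw [charpoly_dirichletOp] at hroots
  have hχ : (-dirichletGenerator (rate t) n).charpoly ≠ 0 :=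
    (LinearMap.charpoly_monic _).ne_zero
  -- The list `hS.eigenvalues` is decreasing and indexed from `0`; `Fin.rev` and `k - 1` make it
  -- increasing and indexed from `1`.
  let idx : ∀ k, k ∈ Set.Ico 1 n → Fin (n - 1) := fun k hk =>
    Fin.rev ⟨k - 1, Nat.sub_lt_sub_right hk.1 hk.2⟩
  classical
  let l : ℕ → ℝ := fun k => if h : k ∈ Set.Ico 1 n then hS.eigenvalues hn (idx k h) else 0
  have hl : ∀ k (hk : k ∈ Set.Ico 1 n), l k = hS.eigenvalues hn (idx k hk) :=
    fun k hk => dif_pos hk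
  have hmemIco : ∀ i : Fin (n - 1), (i : ℕ) + 1 ∈ Set.Ico 1 n := fun i =>
    ⟨by omega, by have := i.2; omega⟩
  have hl' : ∀ i : Fin (n - 1), l (i + 1) = hS.eigenvalues hn i.rev := fun i => by
    rw [hl _ (hmemIco i)]
    rfl
  refine ⟨l, ⟨?_, ?_, ?_, ?_⟩, (hS.eigenvectorBasis hn).reindex Fin.revPerm, fun i => ?_⟩
  · intro a ha b hb hab
    rw [hl a ha, hl b hb]
    refine hanti (Fin.rev_lt_rev.2 ?_)
    have := ha.1
    exact Fin.mk_lt_mk.2 (by omega)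
  · ext z
    rw [Set.mem_ofPred_eq, Module.End.hasEigenvalue_iff_isRoot_charpoly, ← Polynomial.mem_roots hχ,
      hroots]
    simp only [Set.mem_image, Multiset.mem_map, Finset.mem_val, Finset.mem_univ, true_and,
      Function.comp_apply]
    constructor
    · rintro ⟨k, hk, rfl⟩
      exact ⟨idx k hk, by rw [hl k hk]; rfl⟩
    · rintro ⟨i, rfl⟩
      exact ⟨i.rev + 1, hmemIco _, by rw [hl', Fin.rev_rev]; rfl⟩
  · intro k hk
    rw [hl k hk]
    exact hpos _
  · intro k hk
    rw [LinearMap.finrank_maxGenEigenspace_eq, ← Polynomial.count_roots, hroots, hl k hk]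
    refine Multiset.count_eq_one_of_mem (Multiset.Nodup.map ?_ Finset.univ.nodup) ?_
    · exact (RCLike.ofReal_injective (K := ℂ)).comp hinj
    · exact Multiset.mem_map.2 ⟨idx k hk, Finset.mem_univ_val _, rfl⟩
  · rw [OrthonormalBasis.reindex_apply, hl', hS.apply_eigenvectorBasis]
    rfl

/-! ### The Green kernel as inverse, and its stability. -/

/-- The partial sums `t 1 + ⋯ + t x` of the environment. -/
noncomputable def scale (t : ℤ → ℝ) (x : ℤ) : ℝ := ∑ k ∈ Finset.range x.toNat, t (k + 1)

@[simp]
theorem scale_zero (t : ℤ → ℝ) : scale t 0 = 0 := by simp [scale]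

theorem scale_add_one (t : ℤ → ℝ) {x : ℤ} (hx : 0 ≤ x) :
    scale t (x + 1) = scale t x + t (x + 1) := by
  lift x to ℕ using hx
  have h : ((x : ℤ) + 1).toNat = x + 1 := by omega
  rw [scale, scale, h, Finset.sum_range_succ, Int.toNat_natCast]

theorem scale_mono {t : ℤ → ℝ} (ht : ∀ x, 0 < t x) : Monotone (scale t) := by
  intro x y hxy
  refine Finset.sum_le_sum_of_subset_of_nonneg (Finset.range_mono (Int.toNat_le_toNat hxy)) ?_
  exact fun _ _ _ => (ht _).le

theorem scale_nonneg {t : ℤ → ℝ} (ht : ∀ x, 0 < t x) (x : ℤ) : 0 ≤ scale t x :=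
  Finset.sum_nonneg fun _ _ => (ht _).le

theorem scale_pos {t : ℤ → ℝ} (ht : ∀ x, 0 < t x) {x : ℤ} (hx : 0 < x) : 0 < scale t x :=
  Finset.sum_pos (fun _ _ => ht _) (Finset.nonempty_range_iff.2 (by omega))

theorem scale_const (m : ℝ) (x : ℕ) : scale (fun _ => m) x = m * x := by
  simp [scale, mul_comm]

/-- The Green kernel of the walk killed outside `(0,n)`. -/
noncomputable def green (t : ℤ → ℝ) (n : ℕ) (x y : ℤ) : ℝ :=
  scale t (min x y) * (scale t n - scale t (max x y)) / scale t n

/-- After division by `t (x + 1)` the increment depends on `x` only through the side of `y`: the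
flux of the kernel is a step function whose jump is `-1`. -/
theorem green_add_one_sub (t : ℤ → ℝ) (n : ℕ) {x : ℤ} (hx : 0 ≤ x) (y : ℤ) :
    green t n (x + 1) y - green t n x y =
      t (x + 1) * ((if x + 1 ≤ y then scale t n - scale t y else -scale t y) / scale t n) := by
  split_ifs with h
  · rw [green, green, min_eq_left h, max_eq_right h, min_eq_left (by omega),
      max_eq_right (by omega), scale_add_one t hx]
    ring
  · rw [green, green, min_eq_right (by omega), max_eq_left (by omega), min_eq_right (by omega),
      max_eq_left (by omega), scale_add_one t hx]
    ring

/-- The integral operator with the Green kernel. -/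
noncomputable def greenOp (t : ℤ → ℝ) (n : ℕ) : Module.End ℂ (EuclideanIoo n) where
  toFun f := WithLp.toLp 2 fun i => ∑ j : Set.Ioo (0 : ℤ) n, (green t n i j : ℂ) * f j
  map_add' f g := by
    ext i
    simp [mul_add, Finset.sum_add_distrib]
  map_smul' a f := by
    ext i
    simp [Finset.mul_sum, mul_left_comm]

theorem greenOp_apply (t : ℤ → ℝ) {n : ℕ} (f : EuclideanIoo n) (i : Set.Ioo (0 : ℤ) n) :
    greenOp t n f i = ∑ j : Set.Ioo (0 : ℤ) n, (green t n i j : ℂ) * f j := rfl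

theorem extendZero_greenOp (t : ℤ → ℝ) {n : ℕ} (f : EuclideanIoo n) {x : ℤ} (h0 : 0 ≤ x)
    (hn : x ≤ n) :
    extendZero (greenOp t n f) x = ∑ j : Set.Ioo (0 : ℤ) n, (green t n x j : ℂ) * f j := by
  by_cases hx : x ∈ Set.Ioo (0 : ℤ) n
  · exact extendZero_coe (greenOp t n f) ⟨x, hx⟩
  · rw [extendZero_of_notMem _ hx]
    symm
    refine Finset.sum_eq_zero fun j _ => ?_
    have hj := j.2
    rw [Set.mem_Ioo] at hx hj
    rcases (by omega : x = 0 ∨ x = n) with rfl | rfl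
    · simp [green, min_eq_left hj.1.le]
    · simp [green, max_eq_left hj.2.le]

theorem flux_greenOp {t : ℤ → ℝ} (ht : ∀ x, 0 < t x) {n : ℕ} (f : EuclideanIoo n) {x : ℤ}
    (h0 : 0 ≤ x) (hn : x < n) : flux t (extendZero (greenOp t n f)) x =
      ∑ j : Set.Ioo (0 : ℤ) n, (((if x + 1 ≤ (j : ℤ) then scale t n - scale t j else -scale t j) /
        scale t n : ℝ) : ℂ) * f j := by
  have ht0 : (t (x + 1) : ℂ) ≠ 0 := by exact_mod_cast (ht _).ne'
  rw [flux, extendZero_greenOp t f (by omega) (by omega), extendZero_greenOp t f h0 hn.le,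
    ← Finset.sum_sub_distrib, Finset.mul_sum]
  refine Finset.sum_congr rfl fun j _ => ?_
  rw [← sub_mul, ← Complex.ofReal_sub, green_add_one_sub t n h0, Complex.ofReal_mul, mul_assoc,
    inv_mul_cancel_left₀ ht0]

/-- The fluxes through the two edges at `i` differ only in the term `j = i`, where the jump is `-1`.
-/
theorem dirichletOp_mul_greenOp {t : ℤ → ℝ} (ht : ∀ x, 0 < t x) (n : ℕ) :
    dirichletOp t n * greenOp t n = 1 := by
  ext f i
  have hi := i.2
  rw [Set.mem_Ioo] at hi
  have hn0 : scale t n ≠ 0 := (scale_pos ht (by omega)).ne'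
  rw [Module.End.mul_apply, dirichletOp_apply, generator_rate, flux_greenOp ht f hi.1.le hi.2,
    flux_greenOp ht f (by omega) (by omega), ← Finset.sum_sub_distrib, Module.End.one_apply,
    Finset.sum_eq_single i]
  · rw [← sub_mul, ← Complex.ofReal_sub]
    have : (-scale t i / scale t n - (scale t n - scale t i) / scale t n) = -1 := by
      field_simp
      ring
    simp [this]
  · intro j _ hj
    have hj' : (j : ℤ) ≠ i := fun h => hj (Subtype.ext h)
    have h1 : ((i : ℤ) + 1 ≤ j) ↔ (i : ℤ) - 1 + 1 ≤ j := by omega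
    simp only [h1, sub_self]
  · simp

theorem greenOp_mul_dirichletOp {t : ℤ → ℝ} (ht : ∀ x, 0 < t x) (n : ℕ) :
    greenOp t n * dirichletOp t n = 1 :=
  mul_eq_one_comm.1 (dirichletOp_mul_greenOp ht n)

/-- Applied with `a`, `b`, `c` the partial sums at `x ∧ y`, `x ∨ y` and `n`. The constant does not
depend on the sizes of `c` and `c'`, so the bound is uniform in `n`. -/
theorem abs_mul_sub_div_sub_le {a b c a' b' c' δ : ℝ} (hab : a ≤ b) (ha : 0 ≤ a) (hbc : b ≤ c)
    (hab' : a' ≤ b') (ha' : 0 ≤ a') (hbc' : b' ≤ c') (hc : 0 < c) (hc' : 0 < c')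
    (h1 : |a - a'| ≤ δ) (h2 : |b - b'| ≤ δ) (h3 : |c - c'| ≤ δ) :
    |a * (c - b) / c - a' * (c' - b') / c'| ≤ 3 * δ := by
  have hδ : 0 ≤ δ := (abs_nonneg _).trans h1
  -- The three differences appear with coefficients built from `(c - b) / c`, `a' / c'` and `b / c`,
  -- all in `[0, 1]`.
  have key : a * (c - b) / c - a' * (c' - b') / c' =
      (c - b) / c * (a - a') + a' / c' * ((b' - b) + b / c * (c - c')) := by
    field_simp
    ring
  have hunit : ∀ {p q : ℝ}, 0 ≤ p → p ≤ 1 → |p * q| ≤ |q| := fun {p q} hp hp1 => by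
    rw [abs_mul, abs_of_nonneg hp]
    exact mul_le_of_le_one_left (abs_nonneg _) hp1
  rw [key]
  have e1 : |(c - b) / c * (a - a')| ≤ |a - a'| :=
    hunit (div_nonneg (by linarith) hc.le) ((div_le_one hc).2 (by linarith))
  have e2 : |a' / c' * ((b' - b) + b / c * (c - c'))| ≤ |(b' - b) + b / c * (c - c')| :=
    hunit (div_nonneg ha' hc'.le) ((div_le_one hc').2 (by linarith))
  have e3 : |b / c * (c - c')| ≤ |c - c'| :=
    hunit (div_nonneg (by linarith) hc.le) ((div_le_one hc).2 hbc)
  have e4 := abs_add_le (b' - b) (b / c * (c - c'))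
  have e5 := abs_add_le ((c - b) / c * (a - a')) (a' / c' * ((b' - b) + b / c * (c - c')))
  rw [abs_sub_comm b b'] at h2
  linarith

theorem abs_green_sub_le {t t' : ℤ → ℝ} (ht : ∀ x, 0 < t x) (ht' : ∀ x, 0 < t' x) {n : ℕ} {δ : ℝ}
    (h : ∀ x : ℕ, x ≤ n → |scale t x - scale t' x| ≤ δ) (i j : Set.Ioo (0 : ℤ) n) :
    |green t n i j - green t' n i j| ≤ 3 * δ := by
  have hi := i.2
  have hj := j.2
  rw [Set.mem_Ioo] at hi hj
  have h' : ∀ x : ℤ, 0 ≤ x → x ≤ n → |scale t x - scale t' x| ≤ δ := fun x h0 hn => by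
    lift x to ℕ using h0
    exact h x (by exact_mod_cast hn)
  have hmm : min (i : ℤ) j ≤ max i j := min_le_max
  have hmax : max (i : ℤ) j ≤ n := max_le hi.2.le hj.2.le
  have hmin : 0 ≤ min (i : ℤ) j := le_min hi.1.le hj.1.le
  exact abs_mul_sub_div_sub_le (scale_mono ht hmm) (scale_nonneg ht _) (scale_mono ht hmax)
    (scale_mono ht' hmm) (scale_nonneg ht' _) (scale_mono ht' hmax) (scale_pos ht (by omega))
    (scale_pos ht' (by omega)) (h' _ hmin (by omega)) (h' _ (by omega) hmax)
    (h' _ (by omega) le_rfl)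

/-! ### Uniqueness and stability of the eigenvalue list. -/

/-- The Dirichlet eigenvalues are determined by being eigenvalues and by their order. -/
theorem IsDirichletEigenvalueList.eq_of_hasEigenvalue {t : ℤ → ℝ} {n : ℕ} {l r : ℕ → ℝ}
    (hl : IsDirichletEigenvalueList t n l) (hr : StrictMonoOn r (Set.Ico 1 n))
    (hev : ∀ k ∈ Set.Ico 1 n, (-dirichletGenerator (rate t) n).HasEigenvalue (r k : ℂ))
    {k : ℕ} (hk : k ∈ Set.Ico 1 n) : l k = r k := by
  have hIco : ∀ i : Fin (n - 1), (i : ℕ) + 1 ∈ Set.Ico 1 n := fun i =>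
    ⟨by omega, by have := i.2; omega⟩
  have hmono : ∀ {s : ℕ → ℝ}, StrictMonoOn s (Set.Ico 1 n) →
      StrictMono fun i : Fin (n - 1) => s (i + 1) := fun hs i j hij =>
    hs (hIco i) (hIco j) (by have := Fin.lt_def.1 hij; omega)
  have hsub : Set.range (fun i : Fin (n - 1) => r (i + 1)) ⊆
      Set.range fun i : Fin (n - 1) => l (i + 1) := by
    rintro _ ⟨i, rfl⟩
    obtain ⟨q, hq, hqr⟩ := (hl.eigenvalues.symm ▸ hev _ (hIco i) :
      ((r (i + 1) : ℝ) : ℂ) ∈ (fun k => (l k : ℂ)) '' Set.Ico 1 n)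
    have h1 := hq.1
    have h2 := hq.2
    refine ⟨⟨q - 1, by omega⟩, ?_⟩
    rw [← Complex.ofReal_inj, ← hqr]
    simp only [Nat.sub_add_cancel h1]
  have hcard : ∀ {s : ℕ → ℝ}, StrictMonoOn s (Set.Ico 1 n) →
      (Set.range fun i : Fin (n - 1) => s (i + 1)).ncard = n - 1 := fun hs => by
    rw [← Set.image_univ, Set.ncard_image_of_injective _ (hmono hs).injective, Set.ncard_univ,
      Nat.card_fin]
  -- Both value sets have `n - 1` elements, so inclusion is equality, and a set has only one
  -- increasing enumeration.
  have heq := Set.eq_of_subset_of_ncard_le hsub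
    (by rw [hcard hr, hcard hl.strictMono]) (Set.finite_range _)
  have h1 := hk.1
  have h2 := hk.2
  have := congrFun (((hmono hl.strictMono).range_inj (hmono hr)).1 heq.symm)
    ⟨k - 1, by omega⟩
  simpa only [Nat.sub_add_cancel h1] using this

/-- The inverse Dirichlet eigenvalues depend continuously on the partial sums. -/
theorem IsDirichletEigenvalueList.inv_le_inv_add {t t' : ℤ → ℝ} (ht : ∀ x, 0 < t x)
    (ht' : ∀ x, 0 < t' x) {n : ℕ} {l l' : ℕ → ℝ} (hl : IsDirichletEigenvalueList t n l)
    (hl' : IsDirichletEigenvalueList t' n l') {δ : ℝ}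
    (h : ∀ x : ℕ, x ≤ n → |scale t x - scale t' x| ≤ δ) {k : ℕ} (hk : k ∈ Set.Ico 1 n) :
    (l k)⁻¹ ≤ (l' k)⁻¹ + n * (3 * δ) := by
  have hδ : 0 ≤ δ := (abs_nonneg _).trans (h 0 n.zero_le)
  have hIco : ∀ i : Fin (n - 1), (i : ℕ) + 1 ∈ Set.Ico 1 n := fun i =>
    ⟨by omega, by have := i.2; omega⟩
  -- Eigenvectors of `dirichletOp` diagonalize `greenOp` with inverse eigenvalues, which decrease as
  -- Weyl's inequality requires.
  have hbasis : ∀ {t : ℤ → ℝ} {l : ℕ → ℝ}, (∀ x, 0 < t x) → IsDirichletEigenvalueList t n l →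
      Antitone (fun i : Fin (n - 1) => (l (i + 1))⁻¹) ∧
      ∃ u : OrthonormalBasis (Fin (n - 1)) ℂ (EuclideanIoo n),
        ∀ i, greenOp t n (u i) = (((l (i + 1))⁻¹ : ℝ) : ℂ) • u i := by
    intro t l ht hl
    refine ⟨fun i j hij => inv_anti₀ (hl.pos _ (hIco i))
      (hl.strictMono.monotoneOn (hIco i) (hIco j) (Nat.add_le_add_right hij 1)), ?_⟩
    obtain ⟨r, hr, u, hu⟩ := exists_isDirichletEigenvalueList ht n
    refine ⟨u, fun i => ?_⟩
    have hlr : l (i + 1) = r (i + 1) := hl.eq_of_hasEigenvalue hr.strictMono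
      (fun k hk => hr.eigenvalues.subset ⟨k, hk, rfl⟩) (hIco i)
    have h0 : (l (i + 1) : ℂ) ≠ 0 := by exact_mod_cast (hl.pos _ (hIco i)).ne'
    have h1 := congrArg (greenOp t n) (hu i)
    rw [← Module.End.mul_apply, greenOp_mul_dirichletOp ht, Module.End.one_apply, map_smul,
      ← hlr] at h1
    rw [h1, Complex.ofReal_inv, inv_smul_smul₀ h0, ← h1]
  obtain ⟨ha, u, hu⟩ := hbasis ht hl
  obtain ⟨hb, v, hv⟩ := hbasis ht' hl'
  have h1 := hk.1
  have h2 := hk.2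
  have key := u.eigenvalue_le_add_of_re_inner_le v ha hb hu hv (ε := n * (3 * δ)) (fun f => ?_)
    ⟨k - 1, by omega⟩
  · simpa only [Nat.sub_add_cancel h1] using key
  have hD := EuclideanSpace.norm_inner_kernel_le
    (D := fun i j : Set.Ioo (0 : ℤ) n => ((green t n i j - green t' n i j : ℝ) : ℂ))
    (δ := 3 * δ)
    (fun i j => by
      rw [Complex.norm_real, Real.norm_eq_abs]
      exact abs_green_sub_le ht ht' h i j)
    f (greenOp t n f - greenOp t' n f) (fun i => by
      rw [PiLp.sub_apply, greenOp_apply, greenOp_apply, ← Finset.sum_sub_distrib]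
      refine Finset.sum_congr rfl fun j _ => ?_
      rw [Complex.ofReal_sub, sub_mul])
  have hre := (RCLike.re_le_norm (K := ℂ) _).trans hD
  rw [inner_sub_right, map_sub] at hre
  have hcard : (Fintype.card (Set.Ioo (0 : ℤ) n) : ℝ) ≤ n := by
    rw [card_Ioo_natCast]
    exact_mod_cast Nat.sub_le n 1
  have := mul_le_mul_of_nonneg_right (mul_le_mul_of_nonneg_right hcard (by positivity : 0 ≤ 3 * δ))
    (sq_nonneg ‖f‖)
  linarith

/-! ### The constant environment. -/

/-- The eigenfunction is `sin (πkx/n)`, which vanishes at `0` and `n`; the addition formulas give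
the eigenvalue. -/
theorem hasEigenvalue_const (m : ℝ) {n k : ℕ} (hk : k ∈ Set.Ico 1 n) :
    (-dirichletGenerator (rate fun _ => m) n).HasEigenvalue
      ((m⁻¹ * (2 * (1 - Real.cos (Real.pi * k / n))) : ℝ) : ℂ) := by
  classical
  have hk1 : (1 : ℝ) ≤ k := by exact_mod_cast hk.1
  have hkn : (k : ℝ) < n := by exact_mod_cast hk.2
  have hn : (0 : ℝ) < n := by linarith
  set θ : ℝ := Real.pi * k / n with hθ
  let s : ℤ → ℂ := fun x => (Real.sin (θ * x) : ℂ)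
  let F : dirichletSpace n := ⟨fun x => if x ∈ Set.Ioo (0 : ℤ) n then s x else 0,
    fun x hx => if_neg hx⟩
  have hF : ∀ x : ℤ, 0 ≤ x → x ≤ n → F.1 x = s x := by
    intro x h0 h1
    by_cases hx : x ∈ Set.Ioo (0 : ℤ) n
    · exact if_pos hx
    · refine (if_neg hx).trans ?_
      rw [Set.mem_Ioo] at hx
      rcases (by omega : x = 0 ∨ x = n) with rfl | rfl
      · simp [s]
      · have : θ * ((n : ℤ) : ℝ) = k * Real.pi := by
          rw [hθ, Int.cast_natCast]
          field_simp
        simp only [s, this, Real.sin_nat_mul_pi, Complex.ofReal_zero]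
  refine Module.End.hasEigenvalue_of_hasEigenvector (x := F)
    ⟨Module.End.mem_eigenspace_iff.2 ?_, fun h0 => ?_⟩
  · ext x
    by_cases hx : x ∈ Set.Ioo (0 : ℤ) n
    · have h1 : ((-dirichletGenerator (rate fun _ => m) n) F).1 x =
          -generator (rate fun _ => m) F.1 x := congrArg Neg.neg (if_pos hx)
      refine h1.trans ?_
      rw [Set.mem_Ioo] at hx
      rw [generator, rate_sub_one, rate_add_one, hF (x - 1) (by omega) (by omega),
        hF (x + 1) (by omega) (by omega)]
      rw [Submodule.coe_smul, Pi.smul_apply, hF x (by omega) (by omega)]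
      simp only [s, smul_eq_mul]
      norm_cast
      push_cast
      rw [mul_sub_one, mul_add_one, Real.sin_sub, Real.sin_add]
      ring
    · rw [((-dirichletGenerator (rate fun _ => m) n) F).2 x hx, Submodule.coe_smul, Pi.smul_apply,
        F.2 x hx, smul_zero]
  · have h1 : F.1 1 = 0 := by rw [h0]; rfl
    have hn1 : (1 : ℤ) ≤ n := by exact_mod_cast hk.1.trans hk.2.le
    rw [hF 1 (by omega) hn1] at h1
    -- The sine is nonzero at `x = 1`, because `0 < θ < π`.
    have h2 : Real.sin θ = 0 := by
      simpa only [s, Int.cast_one, mul_one, Complex.ofReal_eq_zero] using h1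
    refine (Real.sin_pos_of_pos_of_lt_pi (by positivity) ?_).ne' h2
    rw [hθ, div_lt_iff₀ hn]
    exact mul_lt_mul_of_pos_left hkn Real.pi_pos

theorem IsDirichletEigenvalueList.eq_const {m : ℝ} (hm : 0 < m) {n : ℕ} {l : ℕ → ℝ}
    (hl : IsDirichletEigenvalueList (fun _ => m) n l) {k : ℕ} (hk : k ∈ Set.Ico 1 n) :
    l k = m⁻¹ * (2 * (1 - Real.cos (Real.pi * k / n))) := by
  refine hl.eq_of_hasEigenvalue (r := fun k => m⁻¹ * (2 * (1 - Real.cos (Real.pi * k / n))))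
    (fun a ha b hb hab => ?_) (fun k hk => hasEigenvalue_const m hk) hk
  have hn : (0 : ℝ) < n := by exact_mod_cast (zero_lt_one.trans_le ha.1).trans ha.2
  have hbn : (b : ℝ) ≤ n := by exact_mod_cast hb.2.le
  have hab' : (a : ℝ) < b := by exact_mod_cast hab
  have hcos : Real.cos (Real.pi * b / n) < Real.cos (Real.pi * a / n) := by
    refine Real.cos_lt_cos_of_nonneg_of_le_pi (by positivity) ?_ ?_
    · rw [div_le_iff₀ hn]
      exact mul_le_mul_of_nonneg_left hbn Real.pi_pos.le
    · exact div_lt_div_of_pos_right (mul_lt_mul_of_pos_left hab' Real.pi_pos) hn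
  exact mul_lt_mul_of_pos_left (by linarith) (inv_pos.2 hm)

theorem tendsto_natCast_sq_mul_one_sub_cos (c : ℝ) :
    Tendsto (fun n : ℕ => (n : ℝ) ^ 2 * (2 * (1 - Real.cos (c / n)))) atTop (𝓝 (c ^ 2)) := by
  have h1 : Tendsto (fun n : ℕ => c ^ 2 * Real.sinc (c / 2 / n) ^ 2) atTop
      (𝓝 (c ^ 2 * Real.sinc 0 ^ 2)) :=
    ((Real.continuous_sinc.tendsto 0).comp
      (tendsto_const_div_atTop_nhds_zero_nat (c / 2))).pow 2 |>.const_mul _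
  rw [Real.sinc_zero, one_pow, mul_one] at h1
  refine h1.congr' ?_
  filter_upwards [eventually_gt_atTop 0] with n hn
  have hn0 : (n : ℝ) ≠ 0 := by positivity
  rcases eq_or_ne c 0 with rfl | hc
  · simp
  have h2 : Real.cos (c / n) = 1 - 2 * Real.sin (c / 2 / n) ^ 2 := by
    rw [show c / n = 2 * (c / 2 / n) by ring, Real.cos_two_mul, Real.cos_sq']
    ring
  rw [h2, Real.sinc_of_ne_zero (by positivity)]
  field_simp
  ring

/-! ### Homogenization for a deterministic environment. -/

/-- Beyond `N` the error is at most `ε x ≤ ε n`; the finitely many earlier errors are bounded by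
`C`, which is at most `ε n` for large `n`. -/
theorem eventually_forall_abs_sub_le {S : ℕ → ℝ} {m : ℝ}
    (h : Tendsto (fun n : ℕ => S n / n) atTop (𝓝 m)) {ε : ℝ} (hε : 0 < ε) :
    ∀ᶠ n : ℕ in atTop, ∀ x ≤ n, |S x - m * x| ≤ ε * n := by
  obtain ⟨N, hN⟩ := Metric.tendsto_atTop.1 h ε hε
  set C := ∑ x ∈ Finset.range (N + 1), |S x - m * x|
  filter_upwards [tendsto_natCast_atTop_atTop.eventually_ge_atTop (C / ε)] with n hn x hx
  rw [div_le_iff₀ hε] at hn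
  by_cases hxN : x < N + 1
  · have := Finset.single_le_sum (f := fun x : ℕ => |S x - m * x|) (fun _ _ => abs_nonneg _)
      (Finset.mem_range.2 hxN)
    exact this.trans (by linarith)
  · have hx0 : (0 : ℝ) < x := by exact_mod_cast (by omega : 0 < x)
    have h1 := (hN x (by omega)).le
    rw [Real.dist_eq] at h1
    have h2 : S x - m * x = (S x / x - m) * x := by field_simp
    rw [h2, abs_mul, abs_of_pos hx0]
    exact mul_le_mul h1 (by exact_mod_cast hx) hx0.le hε.le

/-- Homogenization of the Dirichlet eigenvalues for a deterministic environment with a positive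
mean. -/
theorem tendsto_dirichletEigenvalue {t : ℤ → ℝ} (ht : ∀ x, 0 < t x) {m : ℝ} (hm : 0 < m)
    (hS : Tendsto (fun n : ℕ => scale t n / n) atTop (𝓝 m)) {l : ℕ → ℕ → ℝ}
    (hl : ∀ n, IsDirichletEigenvalueList t n (l n)) {k : ℕ} (hk : 1 ≤ k) :
    Tendsto (fun n : ℕ => (n : ℝ) ^ 2 * m * l n k) atTop (𝓝 (Real.pi ^ 2 * (k : ℝ) ^ 2)) := by
  choose l₀ hl₀ _ using fun n : ℕ => exists_isDirichletEigenvalueList (t := fun _ => m)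
    (fun _ => hm) n
  have hk0 : (0 : ℝ) < k := by exact_mod_cast hk
  have hlim₀ : Tendsto (fun n : ℕ => (n : ℝ) ^ 2 * m * l₀ n k) atTop
      (𝓝 (Real.pi ^ 2 * (k : ℝ) ^ 2)) := by
    have h1 := tendsto_natCast_sq_mul_one_sub_cos (Real.pi * k)
    rw [mul_pow] at h1
    refine h1.congr' ?_
    filter_upwards [eventually_gt_atTop k] with n hn
    rw [(hl₀ n).eq_const hm ⟨hk, hn⟩]
    field_simp
  have hdiff : Tendsto (fun n : ℕ => ((n : ℝ) ^ 2 * m * l n k)⁻¹ - ((n : ℝ) ^ 2 * m * l₀ n k)⁻¹)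
      atTop (𝓝 0) := by
    rw [Metric.tendsto_nhds]
    intro ε hε
    -- With `δ = (ε m / 6) n` the bound `n * (3 * δ)` divided by `n² m` is `ε / 2`.
    have hε' : 0 < ε * m / 6 := by positivity
    filter_upwards [eventually_forall_abs_sub_le (S := fun n : ℕ => scale t n) hS hε',
      eventually_gt_atTop k] with n hn hkn
    have hn0 : (0 : ℝ) < n := by exact_mod_cast (by omega : 0 < n)
    have hkI : k ∈ Set.Ico 1 n := ⟨hk, hkn⟩
    have h1 := (hl n).inv_le_inv_add ht (fun _ => hm) (hl₀ n)
      (fun x hx => by rw [scale_const]; exact hn x hx) hkI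
    have h2 := (hl₀ n).inv_le_inv_add (fun _ => hm) ht (hl n)
      (fun x hx => by rw [scale_const, abs_sub_comm]; exact hn x hx) hkI
    have h3 : |(l n k)⁻¹ - (l₀ n k)⁻¹| ≤ n * (3 * (ε * m / 6 * n)) := by
      rw [abs_le]
      constructor <;> linarith
    have h4 : ((n : ℝ) ^ 2 * m * l n k)⁻¹ - ((n : ℝ) ^ 2 * m * l₀ n k)⁻¹ =
        ((n : ℝ) ^ 2 * m)⁻¹ * ((l n k)⁻¹ - (l₀ n k)⁻¹) := by
      rw [mul_inv, mul_inv _ (l₀ n k)]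
      ring
    rw [dist_zero_right, Real.norm_eq_abs, h4, abs_mul, abs_of_pos (by positivity)]
    calc ((n : ℝ) ^ 2 * m)⁻¹ * |(l n k)⁻¹ - (l₀ n k)⁻¹|
        ≤ ((n : ℝ) ^ 2 * m)⁻¹ * (n * (3 * (ε * m / 6 * n))) :=
          mul_le_mul_of_nonneg_left h3 (by positivity)
      _ = ε / 2 := by field_simp; ring
      _ < ε := half_lt_self hε
  -- The limit is nonzero, so convergence of the inverses can be inverted.
  have hne : Real.pi ^ 2 * (k : ℝ) ^ 2 ≠ 0 := by positivity
  have h := (hdiff.add (hlim₀.inv₀ hne)).inv₀ (by simpa using inv_ne_zero hne)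
  simpa using h

/-! ### The ergodic theorem applied to the environment. -/

/-- The observable is `t 1` rather than `t 0` because `scale` starts at the edge `(0, 1)`;
stationarity later gives both the same mean. -/
theorem birkhoffSum_shift (n : ℕ) (t : ℤ → ℝ) :
    birkhoffSum (fun (t : ℤ → ℝ) (x : ℤ) => t (x + 1)) (fun t => t 1) n t = scale t n := by
  have h : ∀ (k : ℕ) (t : ℤ → ℝ) (x : ℤ),
      (fun (t : ℤ → ℝ) (x : ℤ) => t (x + 1))^[k] t x = t (x + k) := by
    intro k
    induction k with
    | zero => simp
    | succ k ih =>
      intro t x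
      rw [Function.iterate_succ_apply, ih]
      push_cast
      ring_nf
  simp only [birkhoffSum, scale, h, Int.toNat_natCast]
  exact Finset.sum_congr rfl fun k _ => by rw [add_comm]

theorem IsErgodicEnvironment.ae_tendsto_scale_div {Ω : Type*} [MeasurableSpace Ω]
    {μ : Measure Ω} [IsProbabilityMeasure μ] {τ : ℤ → Ω → ℝ} (herg : IsErgodicEnvironment μ τ)
    (hmeas : ∀ x, Measurable (τ x)) (hint : Integrable (τ 0) μ) :
    ∀ᵐ ω ∂μ, Tendsto (fun n : ℕ => scale (fun x => τ x ω) n / n) atTop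
      (𝓝 (∫ ω, τ 0 ω ∂μ)) := by
  have hX : Measurable fun ω x => τ x ω := measurable_pi_lambda _ hmeas
  have : IsProbabilityMeasure (μ.map fun ω x => τ x ω) :=
    Measure.isProbabilityMeasure_map hX.aemeasurable
  have hmp := (show Ergodic _ _ from herg).toMeasurePreserving
  have hm : ∀ x : ℤ, Measurable fun t : ℤ → ℝ => t x := measurable_pi_apply
  have h0 : Integrable (fun t : ℤ → ℝ => t 0) (μ.map fun ω x => τ x ω) :=
    (integrable_map_measure (hm 0).aestronglyMeasurable hX.aemeasurable).2 hint
  have h1 : Integrable (fun t : ℤ → ℝ => t 1) (μ.map fun ω x => τ x ω) :=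
    hmp.integrable_comp_of_integrable h0
  have e1 : ∫ t : ℤ → ℝ, t 1 ∂(μ.map fun ω x => τ x ω) = ∫ ω, τ 0 ω ∂μ := by
    have a1 := integral_map (μ := μ.map fun ω x => τ x ω) hmp.measurable.aemeasurable
      (f := fun t : ℤ → ℝ => t 0) (hm 0).aestronglyMeasurable
    rw [hmp.map_eq] at a1
    exact a1.symm.trans (integral_map hX.aemeasurable (hm 0).aestronglyMeasurable)
  have h := Ergodic.ae_tendsto_birkhoffSum_div herg (hm 1) h1
  simp only [birkhoffSum_shift, e1] at h
  exact ae_of_ae_map hX.aemeasurable h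

end BarrierModel

theorem proposition2p6 {Ω : Type*} [MeasurableSpace Ω] (μ : Measure Ω) [IsProbabilityMeasure μ]
    (τ : ℤ → Ω → ℝ) (hmeas : ∀ x, Measurable (τ x))
    (hpos : ∀ x, ∀ᵐ ω ∂μ, 0 < τ x ω)
    (herg : BarrierModel.IsErgodicEnvironment μ τ)
    (hint : Integrable (τ 0) μ) :
    ∀ᵐ ω ∂μ, ∃ l : ℕ → ℕ → ℝ,
      (∀ n : ℕ, BarrierModel.IsDirichletEigenvalueList (fun x => τ x ω) n (l n)) ∧
      ∀ k : ℕ, 1 ≤ k →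
        Tendsto (fun n : ℕ => (n : ℝ) ^ 2 * (∫ ω', τ 0 ω' ∂μ) * l n k) atTop
          (𝓝 (Real.pi ^ 2 * (k : ℝ) ^ 2)) := by
  have hm : 0 < ∫ ω, τ 0 ω ∂μ := by
    rw [integral_pos_iff_support_of_nonneg_ae ((hpos 0).mono fun _ h => h.le) hint]
    have : Function.support (τ 0) =ᵐ[μ] Set.univ :=
      eventuallyEq_univ.2 ((hpos 0).mono fun _ h => h.ne')
    rw [measure_congr this, measure_univ]
    exact one_pos
  filter_upwards [ae_all_iff.2 hpos, herg.ae_tendsto_scale_div hmeas hint] with ω hω hS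
  choose l hl _ using BarrierModel.exists_isDirichletEigenvalueList (t := fun x => τ x ω) hω
  exact ⟨l, hl, fun k hk => BarrierModel.tendsto_dirichletEigenvalue hω hm hS hl hk⟩
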